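/- Setting. Let $f,\theta_1,\dots,\theta_r\in\mathbb R[y]$, $y=(y_1,\dots,y_\ell)$; let $G$ be a symmetric $q\times q$ matrix with entries in $\mathbb R[x]$, $x=(x_1,\dots,x_n)$; and let $P(y,x)=\sum_\beta P_\beta(x)y^\beta$ be a symmetric $m\times m$ polynomial matrix in $(y,x)$. No convexity is assumed. Put $Y=\{y\in\mathbb R^\ell:\theta_1(y)\ge0,\dots,\theta_r(y)\ge0\}$, $X=\{x\in\mathbb R^n: G(x)\succeq0\}$, and $$f^\star=\inf\{f(y): y\in Y,\ P(y,x)\succeq0\ \text{ for all } x\in X\}\in[-\infty,+\infty].\tag{R}$$ Let $k_y$ be the maximum of $\deg f$, $\deg\theta_i$, $\deg_yP_{ij}$, let $k_x$ be the maximum of $\deg_xP_{ij}$ and $\deg G$ (the degree of a matrix is the largest degree of its entries), and let $d_H=\lceil\deg H/2\rceil$ for a polynomial matrix $H$. Relaxations. A symmetric polynomial matrix is SOS if it has the form $T^{\mathsf T}T$ with a polynomial matrix $T$. For a symmetric $p\times p$ polynomial matrix $H$ let $\mathcal Q^m_k(H)$ be the set of all $\Sigma_0+(\Sigma_1,H)_m$,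 where $\Sigma_0$ ($m\times m$) and $\Sigma_1$ ($mp\times mp$) are SOS and $\deg\Sigma_0,\ \deg(\Sigma_1,H)_m\le 2k$; here $(A,B)_m$ is the $m\times m$ matrix of the traces of the $p\times p$ blocks of $A^{\mathsf T}(I_m\otimes B)$. For symmetric $m\times m$ real matrices $S=(S_\alpha)_{|\alpha|\le2k}$ let $M_d(S)=(S_{\alpha+\beta})_{|\alpha|,|\beta|\le d}$ and $M_d(HS)=\big(\sum_\gamma S_{\alpha+\beta+\gamma}\otimes H_\gamma\big)_{|\alpha|,|\beta|\le d}$, where $H=\sum_\gamma H_\gamma x^\gamma$; let $\mathcal M^m_k(H)$ be the set of the $S$ with $M_k(S)\succeq0$ and $M_{k-d_H}(HS)\succeq0$. Put $\Theta=\operatorname{diag}(\theta_1,\dots,\theta_r)$, $\mathcal Q_k=\mathcal Q_k^1$, $\mathcal M_k=\mathcal M_k^1$; let $\mathscr L_S(P(y,x))=\sum_\beta\big(\sum_\alpha \operatorname{tr}(P_{\beta,\alpha}S_\alpha)\big)y^\beta$, where $P_\beta=\sum_\alpha P_{\beta,\alpha}x^\alpha$, and, for a real sequence $s=(s_\beta)_{|\beta|\le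 2k}$, $\mathscr H_s(h)=\sum_\beta h_\beta s_\beta$ for $h=\sum_\beta h_\beta y^\beta\in\mathbb R[y]$ and $\mathscr H_s(P(y,x))=\sum_\beta P_\beta(x)s_\beta$. Define $$f_k^{\rm primal}=\sup\{\rho:\ f-\rho-\mathscr L_S(P(y,x))\in\mathcal Q_k(\Theta),\ \rho\in\mathbb R,\ S\in\mathcal M^m_k(G)\},$$ $$f_k^{\rm dual}=\inf\{\mathscr H_s(f):\ s\in\mathcal M_k(\Theta),\ \mathscr H_s(1)=1,\ \mathscr H_s(P(y,x))\in\mathcal Q^m_k(G)\}.$$ Theorem. Let $k\ge\max\{\lceil k_x/2\rceil,\lceil k_y/2\rceil\}$ and let $s^\star$ be a minimizer of the problem defining $f_k^{\rm dual}$. Suppose that $\operatorname{rank}M_{\lceil k_y/2\rceil}(s^\star)=1$. (i) Then $f_k^{\rm dual}\ge f^\star$, and the truncation $(s^\star_\alpha)_{|\alpha|\le2\lceil k_y/2\rceil}$ has a Dirac representing measure $\delta_{y^\star}$ for some $y^\star\in Y$. (ii) Suppose in addition that $G$ is not constant (i.e. $\deg G\ge1$), that $(\rho^\star,S^\star)$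 is an optimal solution of the problem defining $f_k^{\rm primal}$, that $\operatorname{rank}M_t(S^\star)=\operatorname{rank}M_{t-d_G}(S^\star)$ for some $t$ with $\lceil k_x/2\rceil\le t\le k$, and that $f_k^{\rm primal}=f_k^{\rm dual}$. Then $f_k^{\rm primal}=f_k^{\rm dual}=f^\star$, and every $y^\star$ as in (i) is a minimizer of (R). -/

import Mathlib

noncomputable section

namespace RobustPMI

open MvPolynomial Matrix MeasureTheory
open scoped Kronecker

/-! ## Multi-indices and polynomial matrices -/

/-- The multi-indices `α ∈ ℕⁿ` with `|α| ≤ d`. -/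
def exponents (n d : ℕ) : Finset (Fin n →₀ ℕ) :=
  (Finset.range (d + 1)).biUnion fun e => (Finset.univ : Finset (Fin n)).finsuppAntidiag e

theorem mem_exponents {n d : ℕ} {α : Fin n →₀ ℕ} : α ∈ exponents n d ↔ α.degree ≤ d := by
  simp [exponents, Finset.mem_finsuppAntidiag, Finsupp.degree_eq_sum]

/-- Maximum of the total degrees of the entries (and `0` if there are no entries). -/
def matDegree {n : ℕ} {ι κ A : Type*} [Fintype ι] [Fintype κ] [CommSemiring A]
    (T : Matrix ι κ (MvPolynomial (Fin n) A)) : ℕ :=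
  Finset.univ.sup fun i => Finset.univ.sup fun j => (T i j).totalDegree

/-- The multi-indices of the monomials that appear in some entry. -/
def matSupport {n : ℕ} {ι κ A : Type*} [Fintype ι] [Fintype κ] [CommSemiring A]
    (T : Matrix ι κ (MvPolynomial (Fin n) A)) : Finset (Fin n →₀ ℕ) :=
  Finset.univ.biUnion fun i => Finset.univ.biUnion fun j => (T i j).support

/-- The coefficient matrix of the monomial with multi-index `α`. -/
def matCoeff {n : ℕ} {ι κ A : Type*} [CommSemiring A]
    (T : Matrix ι κ (MvPolynomial (Fin n) A)) (α : Fin n →₀ ℕ) : Matrix ι κ A :=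
  T.map (coeff α)

/-- The value `T(x)` of a real polynomial matrix at a point. -/
def matEval {n : ℕ} {ι κ : Type*} (x : Fin n → ℝ)
    (T : Matrix ι κ (MvPolynomial (Fin n) ℝ)) : Matrix ι κ ℝ :=
  T.map (eval x)

/-- SOS matrices: `Σ = Tᵀ T` for some `l × ι` polynomial matrix `T`. -/
def IsSOSMatrix {n : ℕ} {ι : Type*} (F : Matrix ι ι (MvPolynomial (Fin n) ℝ)) : Prop :=
  ∃ (l : ℕ) (T : Matrix (Fin l) ι (MvPolynomial (Fin n) ℝ)), F = Tᵀ * T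

/-- The blockwise trace of a matrix with `ι × ι` blocks of size `κ × κ`. -/
def blockTrace {ι κ A : Type*} [Fintype κ] [CommSemiring A]
    (C : Matrix (ι × κ) (ι × κ) A) : Matrix ι ι A :=
  Matrix.of fun i j => ∑ a, C (i, a) (j, a)

/-- The bilinear map `(A, B) ↦ blockTrace (Aᵀ (I ⊗ B))`. -/
def blockPair {ι κ A : Type*} [Fintype ι] [DecidableEq ι] [Fintype κ] [CommSemiring A]
    (C : Matrix (ι × κ) (ι × κ) A) (B : Matrix κ κ A) : Matrix ι ι A :=
  blockTrace (Cᵀ * ((1 : Matrix ι ι A) ⊗ₖ B))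

/-- The `k`-th truncated matrix quadratic module of `G`, consisting of `ι × ι` matrices. -/
def truncQuadModule {n : ℕ} (ι : Type*) {κ : Type*} [Fintype ι] [DecidableEq ι] [Fintype κ]
    (k : ℕ) (G : Matrix κ κ (MvPolynomial (Fin n) ℝ)) :
    Set (Matrix ι ι (MvPolynomial (Fin n) ℝ)) :=
  {F | ∃ (F₀ : Matrix ι ι (MvPolynomial (Fin n) ℝ))
      (F₁ : Matrix (ι × κ) (ι × κ) (MvPolynomial (Fin n) ℝ)),
      IsSOSMatrix F₀ ∧ IsSOSMatrix F₁ ∧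
      matDegree F₀ ≤ 2 * k ∧ matDegree (blockPair F₁ G) ≤ 2 * k ∧
      F = F₀ + blockPair F₁ G}

/-! ## Moment and localizing matrices

A sequence truncated at `|α| ≤ 2k` is written as a function on all multi-indices; the notions
below of order at most `k` depend only on its values at `|α| ≤ 2k`. -/

/-- The moment matrix `M_d(S)`, whose `(α, β)` block is `S (α + β)`, `|α|, |β| ≤ d`. -/
def momentMatrix {n : ℕ} {ι : Type*} (d : ℕ) (S : (Fin n →₀ ℕ) → Matrix ι ι ℝ) :
    Matrix (exponents n d × ι) (exponents n d × ι) ℝ :=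
  Matrix.of fun a b => S (a.1 + b.1) a.2 b.2

/-- The localizing matrix `M_d(G S)`, whose `(α, β)` block is `∑ γ, S (α + β + γ) ⊗ G_γ`,
`|α|, |β| ≤ d`. -/
def localizingMatrix {n : ℕ} {ι κ : Type*} [Fintype κ] (d : ℕ)
    (G : Matrix κ κ (MvPolynomial (Fin n) ℝ)) (S : (Fin n →₀ ℕ) → Matrix ι ι ℝ) :
    Matrix (exponents n d × (ι × κ)) (exponents n d × (ι × κ)) ℝ :=
  Matrix.of fun a b =>
    (∑ γ ∈ matSupport G, S (a.1 + b.1 + γ) ⊗ₖ matCoeff G γ) a.2 b.2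

/-- `d_G = ⌈deg G / 2⌉`. -/
def halfDegree {n : ℕ} {κ : Type*} [Fintype κ] (G : Matrix κ κ (MvPolynomial (Fin n) ℝ)) : ℕ :=
  matDegree G ⌈/⌉ 2

/-- The cone of sequences of symmetric matrices with `M_k(S) ⪰ 0` and `M_{k - d_G}(G S) ⪰ 0`
(for `k ≥ d_G`). -/
def truncMomentCone {n : ℕ} (ι : Type*) {κ : Type*} [Fintype κ] (k : ℕ)
    (G : Matrix κ κ (MvPolynomial (Fin n) ℝ)) : Set ((Fin n →₀ ℕ) → Matrix ι ι ℝ) :=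
  {S | (∀ α, α.degree ≤ 2 * k → (S α).IsSymm) ∧ (momentMatrix k S).PosSemidef ∧
    (localizingMatrix (k - halfDegree G) G S).PosSemidef}

/-- A scalar regarded as a `1 × 1` matrix. -/
def scalarMatrix {A : Type*} (a : A) : Matrix (Fin 1) (Fin 1) A := Matrix.of fun _ _ => a

/-- The Riesz functional `L_S(F) = ∑ α, tr (F_α S_α)` of a matrix sequence. -/
def matRiesz {n : ℕ} {ι : Type*} [Fintype ι] (S : (Fin n →₀ ℕ) → Matrix ι ι ℝ)
    (F : Matrix ι ι (MvPolynomial (Fin n) ℝ)) : ℝ :=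
  ∑ α ∈ matSupport F, (matCoeff F α * S α).trace

/-- The Riesz functional `h ↦ ∑ α, h_α s_α` of a real sequence, with values in the coefficient
ring of `h`. -/
def riesz {l : ℕ} {A : Type*} [CommSemiring A] [Module ℝ A] (s : (Fin l →₀ ℕ) → ℝ)
    (h : MvPolynomial (Fin l) A) : A :=
  ∑ α ∈ h.support, s α • h.coeff α

/-- `μ` has the moments `s α` for all `|α| ≤ d`. -/
def Represents {l : ℕ} (d : ℕ) (s : (Fin l →₀ ℕ) → ℝ) (μ : Measure (Fin l → ℝ)) : Prop :=
  ∀ α : Fin l →₀ ℕ, α.degree ≤ d →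
    Integrable (fun y : Fin l → ℝ => ∏ i, y i ^ α i) μ ∧ ∫ y, ∏ i, y i ^ α i ∂μ = s α

/-! ## The robust problem and its relaxations -/

/-- The data of the problem: minimize `f(y)` over the `y` with `θ₁(y) ≥ 0, …, θ_r(y) ≥ 0` and
`P(y, x) ⪰ 0` whenever `G(x) ⪰ 0`. The entries of `P` are polynomials in `y` with coefficients
in `ℝ[x]`, that is, `P = ∑ β, P_β(x) y^β`. -/
structure Problem (l n m q r : ℕ) where
  f : MvPolynomial (Fin l) ℝ
  θ : Fin r → MvPolynomial (Fin l) ℝ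
  G : Matrix (Fin q) (Fin q) (MvPolynomial (Fin n) ℝ)
  P : Matrix (Fin m) (Fin m) (MvPolynomial (Fin l) (MvPolynomial (Fin n) ℝ))
  G_symm : G.IsSymm
  P_symm : P.IsSymm

namespace Problem

variable {l n m q r : ℕ} (D : Problem l n m q r)

/-- The set of decision variables `Y`. -/
def Y : Set (Fin l → ℝ) := {y | ∀ i, 0 ≤ eval y (D.θ i)}

/-- The uncertainty set `X`. -/
def X : Set (Fin n → ℝ) := {x | (matEval x D.G).PosSemidef}

/-- The real matrix `P(y, x)`. -/
def evalP (y : Fin l → ℝ) (x : Fin n → ℝ) : Matrix (Fin m) (Fin m) ℝ :=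
  D.P.map fun p => eval y (MvPolynomial.map (eval x) p)

/-- The feasible set of the robust problem. -/
def feasible : Set (Fin l → ℝ) := {y | y ∈ D.Y ∧ ∀ x ∈ D.X, (D.evalP y x).PosSemidef}

/-- The optimal value `f*`. -/
def optValue : EReal := ⨅ y ∈ D.feasible, ((eval y D.f : ℝ) : EReal)

/-- `y` is a global minimizer of the robust problem. -/
def IsMinimizer (y : Fin l → ℝ) : Prop := y ∈ D.feasible ∧ IsMinOn (fun z => eval z D.f) D.feasible y

/-- The diagonal matrix with entries `θ₁, …, θ_r`. -/
def Θ : Matrix (Fin r) (Fin r) (MvPolynomial (Fin l) ℝ) := Matrix.diagonal D.θ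

/-- `k_y`: the largest of the degrees of `f`, the `θ_i` and the `P_ij` in `y`. -/
def ky : ℕ := max D.f.totalDegree
  (max (Finset.univ.sup fun i => (D.θ i).totalDegree) (matDegree D.P))

/-- `k_x`: the largest of the degrees of the `P_ij` in `x` and of `G`. -/
def kx : ℕ := max
  (Finset.univ.sup fun i => Finset.univ.sup fun j =>
    (D.P i j).support.sup fun β => ((D.P i j).coeff β).totalDegree)
  (matDegree D.G)

/-- `L_S(P(y, x)) = ∑ β, L_S(P_β(x)) y^β`, a polynomial in `y`. -/
def rieszX (S : (Fin n →₀ ℕ) → Matrix (Fin m) (Fin m) ℝ) : MvPolynomial (Fin l) ℝ :=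
  ∑ β ∈ matSupport D.P, monomial β (matRiesz S (matCoeff D.P β))

/-- `H_s(P(y, x)) = ∑ β, P_β(x) s_β`, a polynomial matrix in `x`. -/
def rieszY (s : (Fin l →₀ ℕ) → ℝ) : Matrix (Fin m) (Fin m) (MvPolynomial (Fin n) ℝ) :=
  D.P.map (riesz s)

/-- Feasibility of `(ρ, S)` in the primal relaxation of order `k`. -/
def PrimalFeasible (k : ℕ) (ρ : ℝ) (S : (Fin n →₀ ℕ) → Matrix (Fin m) (Fin m) ℝ) : Prop :=
  scalarMatrix (D.f - C ρ - D.rieszX S) ∈ truncQuadModule (Fin 1) k D.Θ ∧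
    S ∈ truncMomentCone (Fin m) k D.G

/-- The optimal value of the primal relaxation of order `k`. -/
def primalValue (k : ℕ) : EReal :=
  ⨆ (ρ : ℝ) (S : (Fin n →₀ ℕ) → Matrix (Fin m) (Fin m) ℝ) (_ : D.PrimalFeasible k ρ S), (ρ : EReal)

/-- `(ρ, S)` is an optimal solution of the primal relaxation of order `k`. -/
def PrimalOptimal (k : ℕ) (ρ : ℝ) (S : (Fin n →₀ ℕ) → Matrix (Fin m) (Fin m) ℝ) : Prop :=
  D.PrimalFeasible k ρ S ∧ ∀ ρ' S', D.PrimalFeasible k ρ' S' → ρ' ≤ ρ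

/-- Feasibility of `s` in the dual relaxation of order `k`. -/
def DualFeasible (k : ℕ) (s : (Fin l →₀ ℕ) → ℝ) : Prop :=
  (fun α => scalarMatrix (s α)) ∈ truncMomentCone (Fin 1) k D.Θ ∧
    riesz s (1 : MvPolynomial (Fin l) ℝ) = 1 ∧
    D.rieszY s ∈ truncQuadModule (Fin m) k D.G

/-- The optimal value of the dual relaxation of order `k`. -/
def dualValue (k : ℕ) : EReal :=
  ⨅ (s : (Fin l →₀ ℕ) → ℝ) (_ : D.DualFeasible k s), ((riesz s D.f : ℝ) : EReal)

/-- `s` is a minimizer of the dual relaxation of order `k`. -/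
def DualOptimal (k : ℕ) (s : (Fin l →₀ ℕ) → ℝ) : Prop :=
  D.DualFeasible k s ∧ ∀ s', D.DualFeasible k s' → riesz s D.f ≤ riesz s' D.f

/-- The flat extension condition on `S`: `rank M_t(S) = rank M_{t - d_G}(S)` for some
`⌈k_x / 2⌉ ≤ t ≤ k`. -/
def FlatExtension (k : ℕ) (S : (Fin n →₀ ℕ) → Matrix (Fin m) (Fin m) ℝ) : Prop :=
  ∃ t, D.kx ⌈/⌉ 2 ≤ t ∧ t ≤ k ∧
    (momentMatrix t S).rank = (momentMatrix (t - halfDegree D.G) S).rank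

end Problem

end RobustPMI

end

noncomputable section

namespace RobustPMI

open MvPolynomial Matrix MeasureTheory
open scoped Kronecker InnerProductSpace

/-! ## Multi-indices -/

/-! Part (i). If `s 0 = 1` and the moment matrix of order `d` has rank one, its 2×2 minors vanish,
so `s (α + β) = s α * s β` for `|α|, |β| ≤ d`. Hence `s α = y^α` for all `|α| ≤ 2d`, with `y` read
off from the first moments (`eq_monomialValue_of_rank_eq_one`). Since `2d ≥ k_y`, the Riesz
functional of `s` evaluates every polynomial of the problem at `y`: localization gives `θ_i(y) ≥ 0`,
and membership of `P(y, ·)` in the quadratic module gives `P(y, x) ⪰ 0` on `X`. So `y` is feasible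
and the dual value equals `f(y) ≥ f*`.

Part (ii). Flatness of `S` yields `S_α = ∑ u^α W_u` with finitely many atoms `u ∈ X` and Gram
matrices `W_u` (`exists_atomic_representation`). The proof is of GNS type: the columns of a square
root of the moment matrix are Gram vectors, and rank stability makes the shifts `α ↦ α + e_p`
well-defined commuting symmetric operators whose joint eigenvalues are the atoms. For feasible `y`,
`L_S(P(y, ·)) = ∑ tr(P(y, u) W_u) ≥ 0`, so the primal certificate gives `f(y) ≥ ρ`. Thus `ρ ≤ f* ≤`
dual value, and equality of the two relaxation values closes the sandwich. -/

/-- The value `x ^ α` of a monomial at a point. -/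
def monomialValue {n : ℕ} (x : Fin n → ℝ) (α : Fin n →₀ ℕ) : ℝ := ∏ i, x i ^ α i

theorem monomialValue_zero {n : ℕ} (x : Fin n → ℝ) : monomialValue x 0 = 1 := by
  simp [monomialValue]

theorem monomialValue_add {n : ℕ} (x : Fin n → ℝ) (α β : Fin n →₀ ℕ) :
    monomialValue x (α + β) = monomialValue x α * monomialValue x β := by
  simp [monomialValue, pow_add, Finset.prod_mul_distrib]

theorem monomialValue_single {n : ℕ} (x : Fin n → ℝ) (i : Fin n) :
    monomialValue x (Finsupp.single i 1) = x i := by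
  classical
  rw [monomialValue, Finset.prod_eq_single i]
  · simp
  · intro j _ hj
    simp [hj.symm]
  · simp

theorem exists_eq_add_of_degree_le {n a b : ℕ} {α : Fin n →₀ ℕ} (h : α.degree ≤ a + b) :
    ∃ β γ : Fin n →₀ ℕ, β.degree ≤ a ∧ γ.degree ≤ b ∧ α = β + γ := by
  obtain ⟨g, hg, hd⟩ := Finsupp.exists_le_degree_eq α (min a α.degree) (min_le_right _ _)
  obtain ⟨γ, rfl⟩ := le_iff_exists_add.mp hg
  refine ⟨g, γ, by omega, ?_, rfl⟩
  rw [Finsupp.degree.map_add] at h hd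
  omega

theorem exists_eq_add_single {n : ℕ} {α : Fin n →₀ ℕ} (h : α ≠ 0) :
    ∃ (β : Fin n →₀ ℕ) (i : Fin n), α = β + Finsupp.single i 1 := by
  obtain ⟨i, hi⟩ := Finsupp.ne_iff.mp h
  refine ⟨α - Finsupp.single i 1, i, (tsub_add_cancel_of_le ?_).symm⟩
  simpa [Finsupp.single_le_iff] using Nat.one_le_iff_ne_zero.mpr hi

theorem degree_add_single {n : ℕ} (α : Fin n →₀ ℕ) (i : Fin n) :
    (α + Finsupp.single i 1).degree = α.degree + 1 := by
  simp

theorem multiIndex_induction {n : ℕ} {motive : (Fin n →₀ ℕ) → Prop} (zero : motive 0)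
    (add_single : ∀ α i, motive α → motive (α + Finsupp.single i 1)) (α : Fin n →₀ ℕ) :
    motive α := by
  induction h : α.degree generalizing α with
  | zero => rwa [(Finsupp.degree_eq_zero_iff α).mp h]
  | succ N ih =>
    obtain ⟨β, i, rfl⟩ := exists_eq_add_single (α := α) (by rintro rfl; simp at h)
    exact add_single β i (ih β (by rw [degree_add_single] at h; omega))

/-! ## Evaluation of polynomials and of polynomial matrices -/

theorem eval_eq_sum_monomialValue {n : ℕ} (x : Fin n → ℝ) (p : MvPolynomial (Fin n) ℝ)
    {A : Finset (Fin n →₀ ℕ)} (h : p.support ⊆ A) :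
    eval x p = ∑ α ∈ A, coeff α p * monomialValue x α := by
  rw [eval_eq', Finset.sum_subset h]
  · rfl
  · intro α _ hα
    simp [notMem_support_iff.mp hα]

theorem degree_le_of_mem_support {n : ℕ} {A : Type*} [CommSemiring A]
    {p : MvPolynomial (Fin n) A} {α : Fin n →₀ ℕ} (h : α ∈ p.support) :
    α.degree ≤ p.totalDegree :=
  le_totalDegree h

theorem support_subset_matSupport {n : ℕ} {ι κ A : Type*} [Fintype ι] [Fintype κ]
    [CommSemiring A] (T : Matrix ι κ (MvPolynomial (Fin n) A)) (i : ι) (j : κ) :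
    (T i j).support ⊆ matSupport T := fun α hα => by
  simp only [matSupport, Finset.mem_biUnion, Finset.mem_univ, true_and]
  exact ⟨i, j, hα⟩

theorem totalDegree_le_matDegree {n : ℕ} {ι κ A : Type*} [Fintype ι] [Fintype κ]
    [CommSemiring A] (T : Matrix ι κ (MvPolynomial (Fin n) A)) (i : ι) (j : κ) :
    (T i j).totalDegree ≤ matDegree T :=
  (Finset.le_sup (f := fun j => (T i j).totalDegree) (Finset.mem_univ j)).trans
    (Finset.le_sup (f := fun i => Finset.univ.sup fun j => (T i j).totalDegree)
      (Finset.mem_univ i))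

theorem degree_le_of_mem_matSupport {n : ℕ} {ι κ A : Type*} [Fintype ι] [Fintype κ]
    [CommSemiring A] {T : Matrix ι κ (MvPolynomial (Fin n) A)} {α : Fin n →₀ ℕ}
    (h : α ∈ matSupport T) : α.degree ≤ matDegree T := by
  simp only [matSupport, Finset.mem_biUnion, Finset.mem_univ, true_and] at h
  obtain ⟨i, j, h⟩ := h
  exact (degree_le_of_mem_support h).trans (totalDegree_le_matDegree T i j)

/-! ### Quadratic forms, SOS matrices and quadratic modules -/

theorem posSemidef_iff_sum_nonneg {ι : Type*} [Fintype ι] {M : Matrix ι ι ℝ} :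
    M.PosSemidef ↔ M.IsSymm ∧ ∀ z : ι → ℝ, 0 ≤ ∑ i, ∑ j, z i * M i j * z j := by
  rw [posSemidef_iff_dotProduct_mulVec]
  simp [dotProduct, mulVec, Finset.mul_sum, mul_assoc, IsHermitian, IsSymm,
    conjTranspose_eq_transpose_of_trivial]

/-- Splitting `M` into rank-one terms `v vᵀ` turns the pairing with a Gram matrix into a sum of
squared norms `‖∑ v_i w_i‖²`. -/
theorem PosSemidef.sum_mul_inner_nonneg {ι V : Type*} [Fintype ι] [NormedAddCommGroup V]
    [InnerProductSpace ℝ V] {M : Matrix ι ι ℝ} (hM : M.PosSemidef) (w : ι → V) :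
    0 ≤ ∑ i, ∑ j, M i j * ⟪w j, w i⟫_ℝ := by
  obtain ⟨N, v, rfl⟩ := posSemidef_iff_eq_sum_vecMulVec.mp hM
  have key : ∑ i, ∑ j, (∑ a, vecMulVec (v a) (star (v a))) i j * ⟪w j, w i⟫_ℝ
      = ∑ a, ⟪∑ j, v a j • w j, ∑ i, v a i • w i⟫_ℝ := by
    simp only [sum_inner, inner_sum, real_inner_smul_left, real_inner_smul_right, Matrix.sum_apply,
      Finset.sum_mul, vecMulVec_apply, star_trivial]
    rw [Finset.sum_comm_cycle]
    refine Finset.sum_congr rfl fun a _ => ?_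
    exact Finset.sum_congr rfl fun i _ => Finset.sum_congr rfl fun j _ => by
      rw [real_inner_comm]; ring
  rw [key]
  exact Finset.sum_nonneg fun a _ => real_inner_self_nonneg

theorem blockPair_apply {ι κ A : Type*} [Fintype ι] [DecidableEq ι] [Fintype κ]
    [CommSemiring A] (C : Matrix (ι × κ) (ι × κ) A) (B : Matrix κ κ A) (i j : ι) :
    blockPair C B i j = ∑ a, ∑ b, C (j, b) (i, a) * B b a := by
  simp only [blockPair, blockTrace, of_apply, mul_apply, transpose_apply, kroneckerMap_apply,
    one_apply, Fintype.sum_prod_type, ite_mul, one_mul, zero_mul, mul_ite, mul_zero]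
  refine Finset.sum_congr rfl fun a _ => ?_
  rw [Finset.sum_comm]
  simp

theorem quadForm_matEval_nonneg_of_isSOSMatrix {n : ℕ} {ι : Type*} [Fintype ι]
    {F : Matrix ι ι (MvPolynomial (Fin n) ℝ)} (hF : IsSOSMatrix F) (x : Fin n → ℝ) (z : ι → ℝ) :
    0 ≤ ∑ i, ∑ j, z i * matEval x F i j * z j := by
  obtain ⟨N, T, rfl⟩ := hF
  have key : ∑ i, ∑ j, z i * matEval x (Tᵀ * T) i j * z j
      = ∑ a, (∑ i, z i * eval x (T a i)) * ∑ j, z j * eval x (T a j) := by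
    simp only [matEval, map_apply, mul_apply, transpose_apply, map_sum, map_mul, Finset.mul_sum,
      Finset.sum_mul]
    rw [Finset.sum_comm_cycle]
    refine Finset.sum_congr rfl fun a _ => ?_
    rw [Finset.sum_comm]
    exact Finset.sum_congr rfl fun i _ => Finset.sum_congr rfl fun j _ => by ring
  rw [key]
  exact Finset.sum_nonneg fun a _ => mul_self_nonneg _

/-- Contracting each row of `T` with `z` gives a vector `u c`, and the quadratic form of the
`G`-part at `x` becomes `∑ (u c)ᵀ G(x) (u c)`. -/
theorem quadForm_matEval_nonneg_of_mem_truncQuadModule {n k : ℕ} {ι κ : Type*} [Fintype ι]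
    [DecidableEq ι] [Fintype κ] {G : Matrix κ κ (MvPolynomial (Fin n) ℝ)}
    {F : Matrix ι ι (MvPolynomial (Fin n) ℝ)} (hF : F ∈ truncQuadModule ι k G)
    {x : Fin n → ℝ} (hx : (matEval x G).PosSemidef) (z : ι → ℝ) :
    0 ≤ ∑ i, ∑ j, z i * matEval x F i j * z j := by
  obtain ⟨F₀, F₁, h₀, ⟨N, T, rfl⟩, -, -, rfl⟩ := hF
  have h₁ : 0 ≤ ∑ i, ∑ j, z i * matEval x (blockPair (Tᵀ * T) G) i j * z j := by
    let u : Fin N → κ → ℝ := fun c a => ∑ i, z i * eval x (T c (i, a))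
    have key : ∑ i, ∑ j, z i * matEval x (blockPair (Tᵀ * T) G) i j * z j
        = ∑ c, ∑ b, ∑ a, u c b * matEval x G b a * u c a := by
      simp only [u, matEval, map_apply, blockPair_apply, mul_apply, transpose_apply, map_sum,
        map_mul, Finset.mul_sum, Finset.sum_mul]
      -- Pure reordering of a five-fold sum: `c`, `b`, `a` move outside so that `i` and `j` can be
      -- absorbed into the two factors `u c`.
      calc _ = ∑ i, ∑ j, ∑ a, ∑ c, ∑ b, z i * (eval x (T c (j, b)) * eval x (T c (i, a)) *
              eval x (G b a)) * z j := by
            refine Finset.sum_congr rfl fun i _ => Finset.sum_congr rfl fun j _ =>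
              Finset.sum_congr rfl fun a _ => Finset.sum_comm
        _ = ∑ i, ∑ a, ∑ j, ∑ c, ∑ b, z i * (eval x (T c (j, b)) * eval x (T c (i, a)) *
              eval x (G b a)) * z j :=
            Finset.sum_congr rfl fun i _ => Finset.sum_comm
        _ = ∑ i, ∑ a, ∑ c, ∑ b, ∑ j, z i * (eval x (T c (j, b)) * eval x (T c (i, a)) *
              eval x (G b a)) * z j := by
            refine Finset.sum_congr rfl fun i _ => Finset.sum_congr rfl fun a _ => ?_
            rw [Finset.sum_comm]
            exact Finset.sum_congr rfl fun c _ => Finset.sum_comm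
        _ = ∑ i, ∑ c, ∑ b, ∑ a, ∑ j, z i * (eval x (T c (j, b)) * eval x (T c (i, a)) *
              eval x (G b a)) * z j := by
            refine Finset.sum_congr rfl fun i _ => ?_
            rw [Finset.sum_comm]
            exact Finset.sum_congr rfl fun c _ => Finset.sum_comm
        _ = ∑ c, ∑ b, ∑ a, ∑ i, ∑ j, z i * (eval x (T c (j, b)) * eval x (T c (i, a)) *
              eval x (G b a)) * z j := by
            rw [Finset.sum_comm]
            refine Finset.sum_congr rfl fun c _ => ?_
            rw [Finset.sum_comm]
            exact Finset.sum_congr rfl fun b _ => Finset.sum_comm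
        _ = _ := by
            refine Finset.sum_congr rfl fun c _ => Finset.sum_congr rfl fun b _ =>
              Finset.sum_congr rfl fun a _ => Finset.sum_congr rfl fun i _ =>
              Finset.sum_congr rfl fun j _ => by ring
    rw [key]
    exact Finset.sum_nonneg fun c _ => (posSemidef_iff_sum_nonneg.mp hx).2 (u c)
  have h₂ := quadForm_matEval_nonneg_of_isSOSMatrix h₀ x z
  have : matEval x (F₀ + blockPair (Tᵀ * T) G)
      = matEval x F₀ + matEval x (blockPair (Tᵀ * T) G) := by
    ext i j
    simp [matEval]
  simp only [this, Matrix.add_apply, mul_add, add_mul, Finset.sum_add_distrib]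
  exact add_nonneg h₂ h₁

theorem eval_nonneg_of_scalarMatrix_mem_truncQuadModule {n k : ℕ} {κ : Type*} [Fintype κ]
    {G : Matrix κ κ (MvPolynomial (Fin n) ℝ)} {p : MvPolynomial (Fin n) ℝ}
    (hp : scalarMatrix p ∈ truncQuadModule (Fin 1) k G)
    {x : Fin n → ℝ} (hx : (matEval x G).PosSemidef) : 0 ≤ eval x p := by
  simpa [scalarMatrix, matEval] using
    quadForm_matEval_nonneg_of_mem_truncQuadModule hp hx fun _ => 1

theorem riesz_eq_eval {l : ℕ} {s : (Fin l →₀ ℕ) → ℝ} {y : Fin l → ℝ}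
    {p : MvPolynomial (Fin l) ℝ} (h : ∀ α ∈ p.support, s α = monomialValue y α) :
    riesz s p = eval y p := by
  rw [eval_eq_sum_monomialValue y p subset_rfl, riesz]
  exact Finset.sum_congr rfl fun α hα => by rw [h α hα, smul_eq_mul, mul_comm]

theorem eval_map_eq_sum {l n : ℕ} (x : Fin n → ℝ) (y : Fin l → ℝ)
    (p : MvPolynomial (Fin l) (MvPolynomial (Fin n) ℝ)) {A : Finset (Fin l →₀ ℕ)}
    (h : p.support ⊆ A) :
    eval y (MvPolynomial.map (eval x) p)
      = ∑ β ∈ A, eval x (coeff β p) * monomialValue y β := by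
  rw [eval_eq_sum_monomialValue y _ ((support_map_subset _ _).trans h)]
  simp only [coeff_map]

theorem eval_riesz {l n : ℕ} {s : (Fin l →₀ ℕ) → ℝ} {y : Fin l → ℝ}
    {p : MvPolynomial (Fin l) (MvPolynomial (Fin n) ℝ)}
    (h : ∀ α ∈ p.support, s α = monomialValue y α) (x : Fin n → ℝ) :
    eval x (riesz s p) = eval y (MvPolynomial.map (eval x) p) := by
  rw [eval_map_eq_sum x y p subset_rfl, riesz, map_sum]
  exact Finset.sum_congr rfl fun α hα => by rw [h α hα, smul_eval, mul_comm]

/-! ## Moment sequences of rank one -/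

/-- The column space is a line, so all columns are multiples of one vector and every 2×2 minor
vanishes. -/
theorem apply_mul_apply_of_rank_le_one {ι κ : Type*} [Fintype ι] [Fintype κ]
    {M : Matrix ι κ ℝ} (h : M.rank ≤ 1) (i i' : ι) (j j' : κ) :
    M i j * M i' j' = M i j' * M i' j := by
  rw [rank_eq_finrank_span_cols, finrank_le_one_iff] at h
  obtain ⟨v, hv⟩ := h
  have hcol (j : κ) : ∃ c : ℝ, ∀ i, c * v.1 i = M i j := by
    obtain ⟨c, hc⟩ := hv ⟨M.col j, Submodule.subset_span ⟨j, rfl⟩⟩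
    exact ⟨c, fun i => congrFun (congrArg Subtype.val hc) i⟩
  obtain ⟨c, hc⟩ := hcol j
  obtain ⟨c', hc'⟩ := hcol j'
  rw [← hc, ← hc, ← hc', ← hc']
  ring

theorem eq_monomialValue_of_rank_eq_one {l d : ℕ} {s : (Fin l →₀ ℕ) → ℝ} (h0 : s 0 = 1)
    (h : (momentMatrix d (fun α => scalarMatrix (s α))).rank = 1) :
    ∃ y : Fin l → ℝ, ∀ α : Fin l →₀ ℕ, α.degree ≤ 2 * d → s α = monomialValue y α := by
  -- The minor with rows `α, 0` and columns `β, 0`, normalized by `s 0 = 1`.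
  have hmul (α β : Fin l →₀ ℕ) (hα : α.degree ≤ d) (hβ : β.degree ≤ d) :
      s (α + β) = s α * s β := by
    have := apply_mul_apply_of_rank_le_one h.le (⟨α, mem_exponents.mpr hα⟩, 0)
      (⟨0, mem_exponents.mpr (by simp)⟩, 0) (⟨β, mem_exponents.mpr hβ⟩, 0)
      (⟨0, mem_exponents.mpr (by simp)⟩, 0)
    simpa [momentMatrix, scalarMatrix, h0] using this
  refine ⟨fun i => s (Finsupp.single i 1), fun α hα => ?_⟩
  have hsmall (α : Fin l →₀ ℕ) : α.degree ≤ d →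
      s α = monomialValue (fun i => s (Finsupp.single i 1)) α := by
    induction α using multiIndex_induction with
    | zero => simp [h0, monomialValue_zero]
    | add_single α i ih =>
      intro hd
      rw [degree_add_single] at hd
      rw [hmul _ _ (by omega) (by simp; omega), ih (by omega), monomialValue_add,
        monomialValue_single]
  -- The induction only reaches degree `d`; cutting `α` into two halves and multiplying once more
  -- reaches `2d`.
  obtain ⟨β, γ, hβ, hγ, rfl⟩ := exists_eq_add_of_degree_le (two_mul d ▸ hα)
  rw [hmul β γ hβ hγ, hsmall β hβ, hsmall γ hγ, monomialValue_add]

theorem represents_dirac_iff {l d : ℕ} {s : (Fin l →₀ ℕ) → ℝ} {y : Fin l → ℝ} :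
    Represents d s (Measure.dirac y) ↔
      ∀ α : Fin l →₀ ℕ, α.degree ≤ d → s α = monomialValue y α := by
  refine forall₂_congr fun α _ => ?_
  rw [integral_dirac, and_iff_right, eq_comm, monomialValue]
  exact integrable_dirac (by simp)

/-! ## Flat extensions of matrix-valued moment sequences -/

/-! ### Symmetric operators given on a spanning family -/

section Operators

variable {V : Type*} [NormedAddCommGroup V] [InnerProductSpace ℝ V]

theorem eq_of_inner_eq_of_span_eq_top {ι : Type*} {v : ι → V}
    (hv : Submodule.span ℝ (Set.range v) = ⊤) {x y : V} (h : ∀ i, ⟪x, v i⟫_ℝ = ⟪y, v i⟫_ℝ) :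
    x = y := by
  refine ext_inner_right ℝ fun z => ?_
  induction hv ▸ Submodule.mem_top (x := z) using Submodule.span_induction with
  | mem z hz => obtain ⟨i, rfl⟩ := hz; exact h i
  | zero => simp
  | add a b _ _ ha hb => rw [inner_add_right, inner_add_right, ha, hb]
  | smul c a _ ha => rw [inner_smul_right, inner_smul_right, ha]

theorem isSymmetric_of_span_eq_top {ι : Type*} {v : ι → V}
    (hv : Submodule.span ℝ (Set.range v) = ⊤) {X : V →ₗ[ℝ] V}
    (h : ∀ i j, ⟪X (v i), v j⟫_ℝ = ⟪v i, X (v j)⟫_ℝ) : X.IsSymmetric := by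
  have h₁ (i : ι) (z : V) : ⟪X (v i), z⟫_ℝ = ⟪v i, X z⟫_ℝ := by
    induction hv ▸ Submodule.mem_top (x := z) using Submodule.span_induction with
    | mem z hz => obtain ⟨j, rfl⟩ := hz; exact h i j
    | zero => simp
    | add a b _ _ ha hb => rw [inner_add_right, map_add, inner_add_right, ha, hb]
    | smul c a _ ha => rw [inner_smul_right, map_smul, inner_smul_right, ha]
  intro x z
  induction hv ▸ Submodule.mem_top (x := x) using Submodule.span_induction with
  | mem x hx => obtain ⟨i, rfl⟩ := hx; exact h₁ i z
  | zero => simp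
  | add a b _ _ ha hb => rw [inner_add_left, map_add, inner_add_left, ha, hb]
  | smul c a _ ha => rw [inner_smul_left, map_smul, inner_smul_left, ha]

/-- A map on a spanning family that is formally symmetric extends to a symmetric operator. -/
theorem exists_isSymmetric_of_span_eq_top {ι : Type*} {v w : ι → V}
    (hv : Submodule.span ℝ (Set.range v) = ⊤)
    (h : ∀ i j, ⟪w i, v j⟫_ℝ = ⟪v i, w j⟫_ℝ) :
    ∃ X : V →ₗ[ℝ] V, X.IsSymmetric ∧ ∀ i, X (v i) = w i := by
  let Φ := Finsupp.linearCombination ℝ v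
  let Ψ := Finsupp.linearCombination ℝ w
  -- Well-definedness: the pairings of `Ψ c` with the spanning `v j` depend only on `Φ c`, so `Ψ`
  -- composed with any right inverse of `Φ` sends `v i` to `w i`.
  have hsymm (c : ι →₀ ℝ) (j : ι) : ⟪Ψ c, v j⟫_ℝ = ⟪Φ c, w j⟫_ℝ := by
    simp only [Φ, Ψ, Finsupp.linearCombination_apply, Finsupp.sum, sum_inner, inner_smul_left, h]
  obtain ⟨g, hg⟩ := Φ.exists_rightInverse_of_surjective
    (by rw [Finsupp.range_linearCombination, hv])
  have hX (i : ι) : (Ψ ∘ₗ g) (v i) = w i := by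
    refine eq_of_inner_eq_of_span_eq_top hv fun j => ?_
    rw [LinearMap.comp_apply, hsymm, ← LinearMap.comp_apply, hg, LinearMap.id_apply, h]
  exact ⟨Ψ ∘ₗ g, isSymmetric_of_span_eq_top hv fun i j => by rw [hX, hX, h], hX⟩

/-- Commuting symmetric operators: every vector is a finite sum of joint eigenvectors. -/
theorem exists_jointEigenvector_decomposition [FiniteDimensional ℝ V] {n : ℕ}
    {X : Fin n → V →ₗ[ℝ] V} (hX : ∀ p, (X p).IsSymmetric)
    (hc : ∀ p q v, X p (X q v) = X q (X p v)) (v : V) :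
    ∃ w : (Fin n → ℝ) →₀ V, (∀ u p, X p (w u) = u p • w u) ∧ w.sum (fun _ z => z) = v := by
  have htop := LinearMap.IsSymmetric.iSup_iInf_eq_top_of_commute hX
    (fun p q _ => LinearMap.ext fun v => hc p q v)
  obtain ⟨w, hw, hs⟩ := (Submodule.mem_iSup_iff_exists_finsupp _ v).mp
    (htop ▸ Submodule.mem_top (x := v))
  refine ⟨w, fun u p => ?_, hs⟩
  exact Module.End.mem_eigenspace_iff.mp ((Submodule.mem_iInf _).mp (hw u) p)

theorem inner_jointEigenvectors_eq_zero {n : ℕ} {X : Fin n → V →ₗ[ℝ] V}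
    (hX : ∀ p, (X p).IsSymmetric) {u u' : Fin n → ℝ} (hu : u ≠ u') {v v' : V}
    (hv : ∀ p, X p v = u p • v) (hv' : ∀ p, X p v' = u' p • v') : ⟪v, v'⟫_ℝ = 0 := by
  obtain ⟨p, hp⟩ := Function.ne_iff.mp hu
  have h := hX p v v'
  rw [hv, hv', real_inner_smul_left, real_inner_smul_right] at h
  exact (mul_eq_zero.mp (by rw [sub_mul, h, sub_self] :
    (u p - u' p) * ⟪v, v'⟫_ℝ = 0)).resolve_left (sub_ne_zero.mpr hp)

end Operators

/-- Gram vectors of a moment matrix of order `t` that are spanned by those of index at most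
`τ < t` come from finitely many atoms. -/
theorem exists_atoms_of_gram {V ι : Type*} [NormedAddCommGroup V] [InnerProductSpace ℝ V]
    [FiniteDimensional ℝ V] [Finite ι] {n t τ : ℕ} (hτ : τ < t)
    {S : (Fin n →₀ ℕ) → Matrix ι ι ℝ} {b : (Fin n →₀ ℕ) → ι → V}
    (hb : ∀ α β i j, α.degree ≤ t → β.degree ≤ t → ⟪b α i, b β j⟫_ℝ = S (α + β) i j)
    (hspan : Submodule.span ℝ (Set.range fun a : exponents n τ × ι => b a.1 a.2) = ⊤) :
    ∃ (U : Finset (Fin n → ℝ)) (w : (Fin n → ℝ) → ι → V),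
      (∀ u ∈ U, ∃ i, w u i ≠ 0) ∧
      (∀ u ∈ U, ∀ u' ∈ U, u ≠ u' → ∀ i j, ⟪w u i, w u' j⟫_ℝ = 0) ∧
      ∀ α i, α.degree ≤ t → b α i = ∑ u ∈ U, monomialValue u α • w u i := by
  classical
  let v : {α : Fin n →₀ ℕ // α.degree < t} × ι → V := fun a => b a.1 a.2
  -- This is where `τ < t` enters: vectors of degree strictly below `t` already span, and a shift by
  -- one keeps them within the range where the Gram identity holds.
  have hv : Submodule.span ℝ (Set.range v) = ⊤ := by
    refine top_unique (hspan ▸ Submodule.span_mono ?_)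
    rintro _ ⟨⟨⟨α, hα⟩, i⟩, rfl⟩
    exact ⟨⟨⟨α, (mem_exponents.mp hα).trans_lt hτ⟩, i⟩, rfl⟩
  have hop (p : Fin n) : ∃ X : V →ₗ[ℝ] V, X.IsSymmetric ∧
      ∀ α i, α.degree < t → X (b α i) = b (α + Finsupp.single p 1) i := by
    obtain ⟨X, hX, h⟩ := exists_isSymmetric_of_span_eq_top (v := v)
      (w := fun a => b (a.1.1 + Finsupp.single p 1) a.2) hv (by
        rintro ⟨⟨α, hα⟩, i⟩ ⟨⟨β, hβ⟩, j⟩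
        simp only [v]
        rw [hb _ _ _ _ (by rw [degree_add_single]; omega) hβ.le,
          hb _ _ _ _ hα.le (by rw [degree_add_single]; omega)]
        congr 1
        abel_nf)
    exact ⟨X, hX, fun α i hα => h ⟨⟨α, hα⟩, i⟩⟩
  choose X hX hXb using hop
  have hcomm (p q : Fin n) : X p ∘ₗ X q = X q ∘ₗ X p := by
    refine LinearMap.ext_on_range hv ?_
    rintro ⟨⟨α, hα⟩, i⟩
    refine eq_of_inner_eq_of_span_eq_top hv ?_
    rintro ⟨⟨β, hβ⟩, j⟩
    simp only [v, LinearMap.comp_apply]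
    -- Symmetry moves one of the two shifts to the other side, so neither index exceeds degree `t`;
    -- both sides equal `S (α + β + e_p + e_q) i j`.
    rw [hX p (X q _), hX q (X p _), hXb _ _ _ hα, hXb _ _ _ hα, hXb _ _ _ hβ, hXb _ _ _ hβ,
      hb _ _ _ _ (by rw [degree_add_single]; omega) (by rw [degree_add_single]; omega),
      hb _ _ _ _ (by rw [degree_add_single]; omega) (by rw [degree_add_single]; omega)]
    congr 1
    abel_nf
  choose w hw hwsum using fun i => exists_jointEigenvector_decomposition hX
    (fun p q => LinearMap.congr_fun (hcomm p q)) (b 0 i)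
  cases nonempty_fintype ι
  -- The atoms are the joint eigenvalues occurring in the decomposition of some degree-zero vector
  -- `b 0 i`; applying the shifts multiplies each component by its eigenvalues.
  let U : Finset (Fin n → ℝ) := Finset.univ.biUnion fun i => (w i).support
  have hU0 (i : ι) : b 0 i = ∑ u ∈ U, w i u := by
    rw [← hwsum i, Finsupp.sum_of_support_subset _ _ _ (by simp)]
    exact Finset.subset_biUnion_of_mem (fun i => (w i).support) (Finset.mem_univ i)
  refine ⟨U, fun u i => w i u, fun u hu => ?_, fun u _ u' _ huu i j => ?_, fun α => ?_⟩
  · simpa [U] using hu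
  · exact inner_jointEigenvectors_eq_zero hX huu (hw i u) (hw j u')
  · induction α using multiIndex_induction with
    | zero => intro i _; simp [hU0 i, monomialValue_zero]
    | add_single α p ih =>
      intro i hα
      rw [degree_add_single] at hα
      rw [← hXb p α i (by omega), ih i (by omega), map_sum]
      refine Finset.sum_congr rfl fun u _ => ?_
      rw [map_smul, hw, smul_smul, monomialValue_add, monomialValue_single]

/-- Factoring the moment matrix as `Bᵀ B`, the columns of `B` are the Gram vectors. Since `rank Bᵀ B
= rank B`, equal ranks mean that the columns of index at most `τ` span the whole column space, which
is taken as `V`. -/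
theorem exists_gram_of_rank_eq {n t τ : ℕ} {ι : Type*} [Fintype ι] (hτ : τ ≤ t)
    {S : (Fin n →₀ ℕ) → Matrix ι ι ℝ} (hS : (momentMatrix t S).PosSemidef)
    (hrank : (momentMatrix t S).rank = (momentMatrix τ S).rank) :
    ∃ (N : ℕ) (V : Submodule ℝ (EuclideanSpace ℝ (Fin N))) (b : (Fin n →₀ ℕ) → ι → V),
      (∀ α β i j, α.degree ≤ t → β.degree ≤ t → ⟪b α i, b β j⟫_ℝ = S (α + β) i j) ∧
      Submodule.span ℝ (Set.range fun a : exponents n τ × ι => b a.1 a.2) = ⊤ := by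
  classical
  obtain ⟨N, v, hv⟩ := posSemidef_iff_eq_sum_vecMulVec.mp hS
  let B : Matrix (Fin N) (exponents n t × ι) ℝ := Matrix.of v
  have hB : momentMatrix t S = Bᵀ * B := by
    rw [hv]
    ext a c
    simp [Matrix.sum_apply, vecMulVec_apply, mul_apply, B]
  let e : exponents n τ × ι → exponents n t × ι :=
    fun a => (⟨a.1, mem_exponents.mpr ((mem_exponents.mp a.1.2).trans hτ)⟩, a.2)
  have hB' : momentMatrix τ S = (B.submatrix id e)ᵀ * B.submatrix id e := by
    have : momentMatrix τ S = (momentMatrix t S).submatrix e e := rfl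
    rw [this, hB]
    rfl
  let L := (WithLp.linearEquiv 2 ℝ (Fin N → ℝ)).symm
  let g : exponents n t × ι → EuclideanSpace ℝ (Fin N) := fun a => L (B.col a)
  have hspan_eq : Submodule.span ℝ (Set.range (g ∘ e)) = Submodule.span ℝ (Set.range g) := by
    have hle : Submodule.span ℝ (Set.range (B.submatrix id e).col)
        ≤ Submodule.span ℝ (Set.range B.col) := by
      refine Submodule.span_mono ?_
      rintro _ ⟨a, rfl⟩
      exact ⟨e a, rfl⟩
    have heq := Submodule.eq_of_le_of_finrank_eq hle (by
      rw [← rank_eq_finrank_span_cols, ← rank_eq_finrank_span_cols,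
        ← rank_transpose_mul_self, ← rank_transpose_mul_self B, ← hB, ← hB', hrank])
    have h₁ : Set.range (g ∘ e) = L '' Set.range (B.submatrix id e).col := by
      rw [← Set.range_comp]; rfl
    have h₂ : Set.range g = L '' Set.range B.col := by
      rw [← Set.range_comp]; rfl
    have hmap (A : Set (Fin N → ℝ)) : Submodule.span ℝ (L '' A)
        = (Submodule.span ℝ A).map L.toLinearMap := (Submodule.map_span _ _).symm
    rw [h₁, h₂, hmap, hmap, heq]
  let V := Submodule.span ℝ (Set.range g)
  have hmem (a : exponents n t × ι) : g a ∈ V := Submodule.subset_span ⟨a, rfl⟩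
  -- The value `0` beyond degree `t` is a filler; no Gram identity is claimed there.
  let b : (Fin n →₀ ℕ) → ι → V := fun α i =>
    if h : α.degree ≤ t then ⟨g (⟨α, mem_exponents.mpr h⟩, i), hmem _⟩ else 0
  refine ⟨N, V, b, fun α β i j hα hβ => ?_, ?_⟩
  · have := congrFun₂ hB (⟨α, mem_exponents.mpr hα⟩, i) (⟨β, mem_exponents.mpr hβ⟩, j)
    rw [show S (α + β) i j = (Bᵀ * B) _ _ from this]
    simp only [b, hα, hβ, dif_pos, Submodule.coe_inner, PiLp.inner_apply, mul_apply,
      transpose_apply]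
    exact Finset.sum_congr rfl fun a _ => by simp [g, L, mul_comm]
  · refine Submodule.map_injective_of_injective V.injective_subtype ?_
    rw [Submodule.map_span, Submodule.map_top, Submodule.range_subtype, ← Set.range_comp]
    change _ = Submodule.span ℝ (Set.range g)
    rw [← hspan_eq]
    congr 2
    funext a
    have ha : (a.1 : Fin n →₀ ℕ).degree ≤ t := (mem_exponents.mp a.1.2).trans hτ
    simp [b, ha, e]

/-- Writing `α = β + γ` with both parts of degree at most `t` makes the moment an inner product of
Gram vectors; orthogonality of distinct atoms kills the cross terms. -/
theorem eq_sum_monomialValue_of_gram {V ι : Type*} [NormedAddCommGroup V]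
    [InnerProductSpace ℝ V] {n t : ℕ} {S : (Fin n →₀ ℕ) → Matrix ι ι ℝ}
    {b : (Fin n →₀ ℕ) → ι → V} {U : Finset (Fin n → ℝ)} {w : (Fin n → ℝ) → ι → V}
    (hb : ∀ α β i j, α.degree ≤ t → β.degree ≤ t → ⟪b α i, b β j⟫_ℝ = S (α + β) i j)
    (horth : ∀ u ∈ U, ∀ u' ∈ U, u ≠ u' → ∀ i j, ⟪w u i, w u' j⟫_ℝ = 0)
    (hw : ∀ α i, α.degree ≤ t → b α i = ∑ u ∈ U, monomialValue u α • w u i)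
    {α : Fin n →₀ ℕ} (hα : α.degree ≤ 2 * t) (i j : ι) :
    S α i j = ∑ u ∈ U, monomialValue u α * ⟪w u i, w u j⟫_ℝ := by
  obtain ⟨β, γ, hβ, hγ, rfl⟩ := exists_eq_add_of_degree_le (two_mul t ▸ hα)
  rw [← hb β γ i j hβ hγ, hw β i hβ, hw γ j hγ, sum_inner]
  refine Finset.sum_congr rfl fun u hu => ?_
  rw [inner_sum, Finset.sum_eq_single u]
  · rw [real_inner_smul_left, real_inner_smul_right, monomialValue_add, mul_assoc]
  · intro u' hu' hne
    rw [real_inner_smul_left, real_inner_smul_right, horth u hu u' hu' hne.symm]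
    simp
  · exact fun h => absurd hu h

/-! ### Localizing matrices and the location of the atoms -/

theorem exponents_mono {n d d' : ℕ} (h : d ≤ d') : exponents n d ⊆ exponents n d' :=
  fun _ hα => mem_exponents.mpr ((mem_exponents.mp hα).trans h)

theorem localizingMatrix_posSemidef_of_le {n d d' : ℕ} {ι κ : Type*} [Fintype κ] (h : d ≤ d')
    {G : Matrix κ κ (MvPolynomial (Fin n) ℝ)} {S : (Fin n →₀ ℕ) → Matrix ι ι ℝ}
    (hS : (localizingMatrix d' G S).PosSemidef) : (localizingMatrix d G S).PosSemidef := by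
  let e : exponents n d × (ι × κ) → exponents n d' × (ι × κ) :=
    fun a => (⟨a.1.1, exponents_mono h a.1.2⟩, a.2)
  have he : localizingMatrix d G S = (localizingMatrix d' G S).submatrix e e := by
    ext a b
    simp only [localizingMatrix, submatrix_apply, of_apply, e]
  rw [he]
  exact hS.submatrix e

theorem momentMatrix_posSemidef_of_le {n d d' : ℕ} {ι : Type*} (h : d ≤ d')
    {S : (Fin n →₀ ℕ) → Matrix ι ι ℝ}
    (hS : (momentMatrix d' S).PosSemidef) : (momentMatrix d S).PosSemidef := by
  let e : exponents n d × ι → exponents n d' × ι :=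
    fun a => (⟨a.1.1, exponents_mono h a.1.2⟩, a.2)
  have he : momentMatrix d S = (momentMatrix d' S).submatrix e e := by
    ext a b
    simp only [momentMatrix, submatrix_apply, of_apply, e]
  rw [he]
  exact hS.submatrix e

/-- The budget `2τ + deg G ≤ 2t` keeps every index `α + β + γ` in the range where the atomic formula
for `S` is available. -/
theorem localizingMatrix_eq_sum_atoms {V ι κ : Type*} [NormedAddCommGroup V]
    [InnerProductSpace ℝ V] [Fintype κ] {n t τ : ℕ}
    {S : (Fin n →₀ ℕ) → Matrix ι ι ℝ} {U : Finset (Fin n → ℝ)} {w : (Fin n → ℝ) → ι → V}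
    (hS : ∀ α i j, α.degree ≤ 2 * t →
      S α i j = ∑ u ∈ U, monomialValue u α * ⟪w u i, w u j⟫_ℝ)
    {G : Matrix κ κ (MvPolynomial (Fin n) ℝ)} (hG : 2 * τ + matDegree G ≤ 2 * t)
    (α β : exponents n τ) (i j : ι) (c d : κ) :
    localizingMatrix τ G S (α, i, c) (β, j, d) = ∑ u ∈ U,
      monomialValue u α * monomialValue u β * ⟪w u i, w u j⟫_ℝ * matEval u G c d := by
  simp only [localizingMatrix, of_apply, Matrix.sum_apply, kroneckerMap_apply, matCoeff, map_apply,
    matEval]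
  simp only [fun u => eval_eq_sum_monomialValue u (G c d) (support_subset_matSupport G c d),
    Finset.mul_sum]
  rw [Finset.sum_comm]
  refine Finset.sum_congr rfl fun γ hγ => ?_
  have hα := mem_exponents.mp α.2
  have hβ := mem_exponents.mp β.2
  have hγ' := degree_le_of_mem_matSupport hγ
  rw [hS _ _ _ (by rw [Finsupp.degree.map_add, Finsupp.degree.map_add]; omega), Finset.sum_mul]
  refine Finset.sum_congr rfl fun u _ => ?_
  rw [monomialValue_add, monomialValue_add]
  ring

/-- On a product test vector `c ⊗ z` the localizing form separates atom by atom into `‖ω u‖²` times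
`zᵀ G(u) z`. -/
theorem sum_localizingMatrix_eq_sum_atoms {V ι κ : Type*} [NormedAddCommGroup V]
    [InnerProductSpace ℝ V] [Fintype ι] [Fintype κ] {n t τ : ℕ}
    {S : (Fin n →₀ ℕ) → Matrix ι ι ℝ} {U : Finset (Fin n → ℝ)} {w : (Fin n → ℝ) → ι → V}
    (hS : ∀ α i j, α.degree ≤ 2 * t →
      S α i j = ∑ u ∈ U, monomialValue u α * ⟪w u i, w u j⟫_ℝ)
    {G : Matrix κ κ (MvPolynomial (Fin n) ℝ)} (hG : 2 * τ + matDegree G ≤ 2 * t)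
    (c : exponents n τ × ι → ℝ) (z : κ → ℝ) {ω : (Fin n → ℝ) → V}
    (hω : ∀ u, ω u = ∑ a, c a • monomialValue u a.1 • w u a.2) :
    ∑ a, ∑ b, (c (a.1, a.2.1) * z a.2.2) * localizingMatrix τ G S a b *
        (c (b.1, b.2.1) * z b.2.2)
      = ∑ u ∈ U, ⟪ω u, ω u⟫_ℝ * ∑ d, ∑ e, z d * matEval u G d e * z e := by
  have hinner (u : Fin n → ℝ) : ⟪ω u, ω u⟫_ℝ * ∑ d, ∑ e, z d * matEval u G d e * z e
      = ∑ a, ∑ d, ∑ b, ∑ e, (c a * z d) * (monomialValue u a.1 * monomialValue u b.1 *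
        ⟪w u a.2, w u b.2⟫_ℝ * matEval u G d e) * (c b * z e) := by
    simp only [hω, sum_inner, inner_sum, real_inner_smul_left, real_inner_smul_right]
    rw [Finset.sum_comm, Finset.sum_mul_sum]
    refine Finset.sum_congr rfl fun a _ => Finset.sum_congr rfl fun d _ => ?_
    rw [Finset.sum_mul_sum]
    refine Finset.sum_congr rfl fun b _ => Finset.sum_congr rfl fun e _ => ?_
    ring
  simp only [hinner]
  rw [Finset.sum_comm (s := U)]
  simp only [Fintype.sum_prod_type]
  refine Finset.sum_congr rfl fun α _ => Finset.sum_congr rfl fun i _ => ?_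
  rw [Finset.sum_comm (s := U)]
  refine Finset.sum_congr rfl fun d _ => ?_
  rw [Finset.sum_comm (s := U)]
  refine Finset.sum_congr rfl fun β _ => ?_
  rw [Finset.sum_comm (s := U)]
  refine Finset.sum_congr rfl fun j _ => ?_
  rw [Finset.sum_comm (s := U)]
  refine Finset.sum_congr rfl fun e _ => ?_
  rw [localizingMatrix_eq_sum_atoms hS hG, Finset.mul_sum, Finset.sum_mul]

/-- A single atom can be isolated: the Gram vectors of index at most `τ` span, so some coefficients
`c` produce the vector `w u i`. Testing the localizing matrix on `c ⊗ z` then leaves only `‖w u i‖²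
zᵀ G(u) z`. -/
theorem matEval_posSemidef_of_atoms {V ι κ : Type*} [NormedAddCommGroup V]
    [InnerProductSpace ℝ V] [Fintype ι] [Fintype κ] {n t τ : ℕ} {S : (Fin n →₀ ℕ) → Matrix ι ι ℝ}
    {U : Finset (Fin n → ℝ)} {w : (Fin n → ℝ) → ι → V}
    (hS : ∀ α i j, α.degree ≤ 2 * t →
      S α i j = ∑ u ∈ U, monomialValue u α * ⟪w u i, w u j⟫_ℝ)
    (horth : ∀ u ∈ U, ∀ u' ∈ U, u ≠ u' → ∀ i j, ⟪w u i, w u' j⟫_ℝ = 0)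
    (hspan : Submodule.span ℝ (Set.range fun a : exponents n τ × ι =>
      ∑ u ∈ U, monomialValue u a.1 • w u a.2) = ⊤)
    {G : Matrix κ κ (MvPolynomial (Fin n) ℝ)} (hGsymm : G.IsSymm)
    (hG : 2 * τ + matDegree G ≤ 2 * t) (hloc : (localizingMatrix τ G S).PosSemidef)
    {u : Fin n → ℝ} (hu : u ∈ U) (hne : ∃ i, w u i ≠ 0) : (matEval u G).PosSemidef := by
  refine posSemidef_iff_sum_nonneg.mpr ⟨?_, fun z => ?_⟩
  · ext c d
    simp [matEval, hGsymm.apply c d]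
  obtain ⟨i, hi⟩ := hne
  obtain ⟨c, hc⟩ := (Submodule.mem_span_range_iff_exists_fun ℝ).mp
    (hspan ▸ Submodule.mem_top (x := w u i))
  -- `ω u'` is the contribution of the atom `u'` to the combination with coefficients `c`; by
  -- orthogonality it vanishes for `u' ≠ u` and equals `w u i` at `u`.
  obtain ⟨ω, hω⟩ : ∃ ω : (Fin n → ℝ) → V,
      ∀ u, ω u = ∑ a, c a • monomialValue u a.1 • w u a.2 := ⟨_, fun _ => rfl⟩
  have hsum : w u i = ∑ u' ∈ U, ω u' := by
    simp only [hω]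
    rw [← hc, Finset.sum_comm]
    exact Finset.sum_congr rfl fun a _ => Finset.smul_sum
  have horthω (u₁ : Fin n → ℝ) (h₁ : u₁ ∈ U) (u₂ : Fin n → ℝ) (h₂ : u₂ ∈ U) (h : u₁ ≠ u₂)
      (j : ι) : ⟪w u₁ j, ω u₂⟫_ℝ = 0 := by
    simp only [hω, inner_sum, real_inner_smul_right, horth u₁ h₁ u₂ h₂ h, mul_zero,
      Finset.sum_const_zero]
  have hω0 (u' : Fin n → ℝ) (hu' : u' ∈ U) (h : u' ≠ u) : ω u' = 0 := by
    have h0 := horthω u hu u' hu' h.symm i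
    rw [hsum, sum_inner, Finset.sum_eq_single_of_mem u' hu'] at h0
    · exact inner_self_eq_zero.mp h0
    · intro u₁ h₁ hne₁
      rw [hω u₁, sum_inner]
      refine Finset.sum_eq_zero fun a _ => ?_
      rw [real_inner_smul_left, real_inner_smul_left, horthω u₁ h₁ u' hu' hne₁, mul_zero, mul_zero]
  have hωu : ω u = w u i := by
    rw [hsum, Finset.sum_eq_single_of_mem u hu hω0]
  have hpos := (posSemidef_iff_sum_nonneg.mp hloc).2 fun a => c (a.1, a.2.1) * z a.2.2
  rw [sum_localizingMatrix_eq_sum_atoms hS hG c z hω, Finset.sum_eq_single_of_mem u hu, hωu] at hpos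
  · exact nonneg_of_mul_nonneg_right hpos (real_inner_self_pos.mpr hi)
  · intro u' hu' h
    rw [hω0 u' hu' h, inner_zero_left, zero_mul]

/-- The flat extension theorem for matrix-valued moment sequences: a sequence `S` that is flat in
the sense `rank M_t(S) = rank M_τ(S)`, with `M_τ(G S) ⪰ 0`, has a finitely atomic representation
whose atoms satisfy `G(u) ⪰ 0`. -/
theorem exists_atomic_representation {n t τ : ℕ} {ι κ : Type*} [Fintype ι] [Fintype κ]
    (hτ : τ < t) {S : (Fin n →₀ ℕ) → Matrix ι ι ℝ} (hS : (momentMatrix t S).PosSemidef)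
    (hrank : (momentMatrix t S).rank = (momentMatrix τ S).rank)
    {G : Matrix κ κ (MvPolynomial (Fin n) ℝ)} (hGsymm : G.IsSymm)
    (hG : 2 * τ + matDegree G ≤ 2 * t) (hloc : (localizingMatrix τ G S).PosSemidef) :
    ∃ (N : ℕ) (V : Submodule ℝ (EuclideanSpace ℝ (Fin N))) (U : Finset (Fin n → ℝ))
      (w : (Fin n → ℝ) → ι → V), (∀ u ∈ U, (matEval u G).PosSemidef) ∧
      ∀ α i j, α.degree ≤ 2 * t →
        S α i j = ∑ u ∈ U, monomialValue u α * ⟪w u i, w u j⟫_ℝ := by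
  obtain ⟨N, V, b, hb, hspan⟩ := exists_gram_of_rank_eq hτ.le hS hrank
  obtain ⟨U, w, hne, horth, hw⟩ := exists_atoms_of_gram hτ hb hspan
  have hS' : ∀ α i j, α.degree ≤ 2 * t →
      S α i j = ∑ u ∈ U, monomialValue u α * ⟪w u i, w u j⟫_ℝ :=
    fun α i j hα => eq_sum_monomialValue_of_gram hb horth hw hα i j
  have hfun : (fun a : exponents n τ × ι => b a.1 a.2)
      = fun a => ∑ u ∈ U, monomialValue u a.1 • w u a.2 :=
    funext fun a => hw _ _ ((mem_exponents.mp a.1.2).trans hτ.le)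
  exact ⟨N, V, U, w, fun u hu => matEval_posSemidef_of_atoms hS' horth (hfun ▸ hspan) hGsymm hG
    hloc hu (hne u hu), hS'⟩

theorem matRiesz_eq_sum_atoms {V ι : Type*} [NormedAddCommGroup V] [InnerProductSpace ℝ V]
    [Fintype ι] {n t : ℕ} {S : (Fin n →₀ ℕ) → Matrix ι ι ℝ} {U : Finset (Fin n → ℝ)}
    {w : (Fin n → ℝ) → ι → V}
    (hS : ∀ α i j, α.degree ≤ 2 * t →
      S α i j = ∑ u ∈ U, monomialValue u α * ⟪w u i, w u j⟫_ℝ)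
    {F : Matrix ι ι (MvPolynomial (Fin n) ℝ)} (hF : matDegree F ≤ 2 * t) :
    matRiesz S F = ∑ u ∈ U, ∑ i, ∑ j, matEval u F i j * ⟪w u j, w u i⟫_ℝ := by
  simp only [matEval, map_apply, matRiesz, trace, diag_apply, mul_apply, matCoeff,
    fun u i j => eval_eq_sum_monomialValue u (F i j) (support_subset_matSupport F i j),
    Finset.sum_mul]
  rw [Finset.sum_comm, Finset.sum_comm (s := U)]
  refine Finset.sum_congr rfl fun i _ => ?_
  rw [Finset.sum_comm, Finset.sum_comm (s := U)]
  refine Finset.sum_congr rfl fun j _ => ?_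
  rw [Finset.sum_comm]
  refine Finset.sum_congr rfl fun α hα => ?_
  rw [hS α j i ((degree_le_of_mem_matSupport hα).trans hF), Finset.mul_sum]
  exact Finset.sum_congr rfl fun u _ => by ring

/-! ## The robust problem and its relaxations -/

theorem le_two_mul_ceilDiv_two (a : ℕ) : a ≤ 2 * (a ⌈/⌉ 2) := by
  rw [Nat.ceilDiv_eq_add_pred_div]
  omega

theorem ceilDiv_two_mono {a b : ℕ} (h : a ≤ b) : a ⌈/⌉ 2 ≤ b ⌈/⌉ 2 := by
  rw [Nat.ceilDiv_eq_add_pred_div, Nat.ceilDiv_eq_add_pred_div]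
  omega

namespace Problem

variable {l n m q r : ℕ} (D : Problem l n m q r)

theorem totalDegree_f_le_ky : D.f.totalDegree ≤ D.ky := le_max_left _ _

theorem totalDegree_θ_le_ky (i : Fin r) : (D.θ i).totalDegree ≤ D.ky :=
  (Finset.le_sup (f := fun i => (D.θ i).totalDegree) (Finset.mem_univ i)).trans
    ((le_max_left _ _).trans (le_max_right _ _))

theorem matDegree_P_le_ky : matDegree D.P ≤ D.ky :=
  (le_max_right _ _).trans (le_max_right _ _)

theorem matDegree_G_le_kx : matDegree D.G ≤ D.kx := le_max_right _ _

theorem matDegree_matCoeff_P_le_kx (β : Fin l →₀ ℕ) : matDegree (matCoeff D.P β) ≤ D.kx := by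
  refine Finset.sup_le fun i _ => Finset.sup_le fun j _ => ?_
  by_cases hβ : β ∈ (D.P i j).support
  · refine le_trans ?_ (le_max_left _ _)
    refine le_trans ?_ (Finset.le_sup (f := fun i => Finset.univ.sup fun j =>
      (D.P i j).support.sup fun β => ((D.P i j).coeff β).totalDegree) (Finset.mem_univ i))
    refine le_trans ?_ (Finset.le_sup (f := fun j =>
      (D.P i j).support.sup fun β => ((D.P i j).coeff β).totalDegree) (Finset.mem_univ j))
    exact Finset.le_sup (f := fun β => ((D.P i j).coeff β).totalDegree) hβ
  · simp [matCoeff, notMem_support_iff.mp hβ]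

theorem halfDegree_G_le : halfDegree D.G ≤ D.kx ⌈/⌉ 2 := ceilDiv_two_mono D.matDegree_G_le_kx

theorem matEval_Θ_posSemidef {y : Fin l → ℝ} (hy : y ∈ D.Y) : (matEval y D.Θ).PosSemidef := by
  have : matEval y D.Θ = Matrix.diagonal fun i => eval y (D.θ i) :=
    Matrix.diagonal_map (map_zero _)
  rw [this]
  exact PosSemidef.diagonal hy

/-! ### Lower bound on `f*` from a flat primal solution -/

theorem eval_rieszX {V : Type*} [NormedAddCommGroup V] [InnerProductSpace ℝ V] {t : ℕ}
    {S : (Fin n →₀ ℕ) → Matrix (Fin m) (Fin m) ℝ} {U : Finset (Fin n → ℝ)}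
    {w : (Fin n → ℝ) → Fin m → V}
    (hS : ∀ α i j, α.degree ≤ 2 * t →
      S α i j = ∑ u ∈ U, monomialValue u α * ⟪w u i, w u j⟫_ℝ)
    (ht : D.kx ≤ 2 * t) (y : Fin l → ℝ) :
    eval y (D.rieszX S) = ∑ u ∈ U, ∑ i, ∑ j, D.evalP y u i j * ⟪w u j, w u i⟫_ℝ := by
  have hmon (β : Fin l →₀ ℕ) (c : ℝ) : eval y (monomial β c) = c * monomialValue y β := by
    rw [eval_monomial, monomialValue, Finsupp.prod_fintype _ _ fun i => pow_zero _]
  have hriesz (β : Fin l →₀ ℕ) : matRiesz S (matCoeff D.P β)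
      = ∑ u ∈ U, ∑ i, ∑ j, matEval u (matCoeff D.P β) i j * ⟪w u j, w u i⟫_ℝ :=
    matRiesz_eq_sum_atoms hS ((D.matDegree_matCoeff_P_le_kx β).trans ht)
  simp only [rieszX, map_sum, hmon, hriesz]
  simp only [evalP, map_apply, matEval, matCoeff,
    fun u i j => eval_map_eq_sum u y (D.P i j) (support_subset_matSupport D.P i j),
    Finset.sum_mul]
  rw [Finset.sum_comm]
  refine Finset.sum_congr rfl fun u _ => ?_
  rw [Finset.sum_comm]
  refine Finset.sum_congr rfl fun i _ => ?_
  rw [Finset.sum_comm]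
  refine Finset.sum_congr rfl fun j _ => Finset.sum_congr rfl fun β _ => by ring

theorem eval_rieszX_nonneg {k : ℕ} {S : (Fin n →₀ ℕ) → Matrix (Fin m) (Fin m) ℝ}
    (hG : 1 ≤ matDegree D.G) (hS : S ∈ truncMomentCone (Fin m) k D.G)
    (hflat : D.FlatExtension k S) {y : Fin l → ℝ} (hy : y ∈ D.feasible) :
    0 ≤ eval y (D.rieszX S) := by
  obtain ⟨t, hkt, htk, hrank⟩ := hflat
  have hd : matDegree D.G ≤ 2 * halfDegree D.G := le_two_mul_ceilDiv_two _
  have hdt := D.halfDegree_G_le.trans hkt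
  -- Nonconstancy of `G` gives `d_G ≥ 1`; with `d_G ≤ ⌈k_x/2⌉ ≤ t`, the truncated subtraction `t -
  -- d_G` is strictly below `t` and `2(t - d_G) + deg G ≤ 2t`.
  obtain ⟨N, V, U, w, hU, hw⟩ := exists_atomic_representation (by omega)
    (momentMatrix_posSemidef_of_le htk hS.2.1) hrank D.G_symm (by omega)
    (localizingMatrix_posSemidef_of_le (by omega) hS.2.2)
  rw [D.eval_rieszX hw ((le_two_mul_ceilDiv_two _).trans (by omega)) y]
  exact Finset.sum_nonneg fun u hu =>
    PosSemidef.sum_mul_inner_nonneg (hy.2 u (hU u hu)) (w u)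

theorem le_optValue_of_primalFeasible {k : ℕ} {ρ : ℝ}
    {S : (Fin n →₀ ℕ) → Matrix (Fin m) (Fin m) ℝ} (hG : 1 ≤ matDegree D.G)
    (h : D.PrimalFeasible k ρ S) (hflat : D.FlatExtension k S) : (ρ : EReal) ≤ D.optValue := by
  refine le_iInf₂ fun y hy => EReal.coe_le_coe_iff.mpr ?_
  have h₁ := eval_nonneg_of_scalarMatrix_mem_truncQuadModule h.1 (D.matEval_Θ_posSemidef hy.1)
  have h₂ := D.eval_rieszX_nonneg hG h.2 hflat hy
  rw [map_sub, map_sub, eval_C] at h₁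
  linarith

variable {D}

theorem PrimalOptimal.primalValue_eq {k : ℕ} {ρ : ℝ}
    {S : (Fin n →₀ ℕ) → Matrix (Fin m) (Fin m) ℝ} (h : D.PrimalOptimal k ρ S) :
    D.primalValue k = ρ :=
  le_antisymm (iSup_le fun ρ' => iSup₂_le fun S' h' => EReal.coe_le_coe_iff.mpr (h.2 ρ' S' h'))
    (le_iSup_of_le ρ (le_iSup₂_of_le S h.1 le_rfl))

theorem DualOptimal.dualValue_eq {k : ℕ} {s : (Fin l →₀ ℕ) → ℝ} (h : D.DualOptimal k s) :
    D.dualValue k = riesz s D.f :=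
  le_antisymm (iInf₂_le s h.1) (le_iInf₂ fun s' h' => EReal.coe_le_coe_iff.mpr (h.2 s' h'))

/-! ### Points whose monomials agree with `s` up to degree `k_y` -/

section Dirac

variable {k : ℕ} {s : (Fin l →₀ ℕ) → ℝ} {y : Fin l → ℝ}

theorem riesz_f_eq_eval (hy : ∀ α : Fin l →₀ ℕ, α.degree ≤ D.ky → s α = monomialValue y α) :
    riesz s D.f = eval y D.f :=
  riesz_eq_eval fun α hα => hy α ((degree_le_of_mem_support hα).trans D.totalDegree_f_le_ky)

theorem mem_Y_of_dualFeasible (hs : D.DualFeasible k s)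
    (hy : ∀ α : Fin l →₀ ℕ, α.degree ≤ D.ky → s α = monomialValue y α) : y ∈ D.Y := by
  intro i
  -- The diagonal entry at `α = β = 0` and block position `(i, i)` is the Riesz functional of `θ_i`,
  -- that is, `θ_i(y)`.
  have h := hs.1.2.2.diag_nonneg (i := (⟨0, mem_exponents.mpr (by simp)⟩, 0, i))
  rw [eval_eq_sum_monomialValue y _ ((congrArg support (diagonal_apply_eq D.θ i)).ge.trans
    (support_subset_matSupport D.Θ i i))]
  refine h.trans_eq ?_
  simp only [localizingMatrix, of_apply, Matrix.sum_apply, kroneckerMap_apply, matCoeff, map_apply,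
    scalarMatrix, zero_add]
  refine Finset.sum_congr rfl fun γ hγ => ?_
  rw [show D.Θ i i = D.θ i from diagonal_apply_eq D.θ i]
  by_cases h0 : γ ∈ (D.θ i).support
  · rw [hy γ ((degree_le_of_mem_support h0).trans (D.totalDegree_θ_le_ky i)), mul_comm]
  · simp [notMem_support_iff.mp h0]

/-- Agreement of moments up to `k_y` identifies `P(y, x)` with the value at `x` of `H_s(P)`, which
is nonnegative on `X` by its quadratic module certificate. Stated for any such `y`, it serves both
the point constructed from rank one and every other representing point. -/
theorem mem_feasible_of_dualFeasible (hs : D.DualFeasible k s)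
    (hy : ∀ α : Fin l →₀ ℕ, α.degree ≤ D.ky → s α = monomialValue y α) : y ∈ D.feasible := by
  refine ⟨mem_Y_of_dualFeasible hs hy, fun x hx => posSemidef_iff_sum_nonneg.mpr ⟨?_, fun z => ?_⟩⟩
  · ext i j
    simp [evalP, D.P_symm.apply i j]
  · have heq : D.evalP y x = matEval x (D.rieszY s) := by
      ext i j
      simp only [evalP, matEval, rieszY, map_apply]
      exact (eval_riesz (fun α hα => hy α ((degree_le_of_mem_support hα).trans
        ((totalDegree_le_matDegree D.P i j).trans D.matDegree_P_le_ky))) x).symm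
    rw [heq]
    exact quadForm_matEval_nonneg_of_mem_truncQuadModule hs.2.2 hx z

end Dirac

end Problem

end RobustPMI

end

theorem mainTheorem12 {l n m q r : ℕ} (D : RobustPMI.Problem l n m q r) (k : ℕ)
    (hk : max (D.kx ⌈/⌉ 2) (D.ky ⌈/⌉ 2) ≤ k)
    (s : (Fin l →₀ ℕ) → ℝ) (hs : D.DualOptimal k s)
    (hrank : (RobustPMI.momentMatrix (D.ky ⌈/⌉ 2)
      (fun α => RobustPMI.scalarMatrix (s α))).rank = 1) :
    (D.optValue ≤ D.dualValue k ∧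
      ∃ y ∈ D.Y, RobustPMI.Represents (2 * (D.ky ⌈/⌉ 2)) s (MeasureTheory.Measure.dirac y)) ∧
    (∀ (ρ : ℝ) (S : (Fin n →₀ ℕ) → Matrix (Fin m) (Fin m) ℝ),
      1 ≤ RobustPMI.matDegree D.G → D.PrimalOptimal k ρ S → D.FlatExtension k S →
      D.primalValue k = D.dualValue k →
      D.primalValue k = D.optValue ∧ D.dualValue k = D.optValue ∧
      ∀ y ∈ D.Y,
        RobustPMI.Represents (2 * (D.ky ⌈/⌉ 2)) s (MeasureTheory.Measure.dirac y) →
        D.IsMinimizer y) := by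
  have h0 : s 0 = 1 := by
    simpa [RobustPMI.riesz, MvPolynomial.support_one] using hs.1.2.1
  obtain ⟨y, hy⟩ := RobustPMI.eq_monomialValue_of_rank_eq_one h0 hrank
  have hky := RobustPMI.le_two_mul_ceilDiv_two D.ky
  have hyf := RobustPMI.Problem.mem_feasible_of_dualFeasible hs.1 fun α hα => hy α (hα.trans hky)
  have hle : D.optValue ≤ D.dualValue k := by
    rw [hs.dualValue_eq, RobustPMI.Problem.riesz_f_eq_eval fun α hα => hy α (hα.trans hky)]
    exact iInf₂_le y hyf
  refine ⟨⟨hle, y, hyf.1, RobustPMI.represents_dirac_iff.mpr hy⟩, fun ρ S hG hρ hflat heq => ?_⟩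
  -- The sandwich: dual value = primal value = `ρ ≤ f* ≤` dual value.
  have hopt : D.dualValue k = D.optValue := by
    refine le_antisymm ?_ hle
    rw [← heq, hρ.primalValue_eq]
    exact D.le_optValue_of_primalFeasible hG hρ.1 hflat
  refine ⟨heq.trans hopt, hopt, fun y' _ hy' => ?_⟩
  have hy'' : ∀ α : Fin l →₀ ℕ, α.degree ≤ D.ky → s α = RobustPMI.monomialValue y' α :=
    fun α hα => RobustPMI.represents_dirac_iff.mp hy' α (hα.trans hky)
  refine ⟨RobustPMI.Problem.mem_feasible_of_dualFeasible hs.1 hy'', fun z hz => ?_⟩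
  -- Since `f*` equals the dual value `f(y')`, this bound says `f(y') ≤ f(z)`.
  have hz' : D.optValue ≤ ((MvPolynomial.eval z D.f : ℝ) : EReal) := iInf₂_le z hz
  rw [← hopt, hs.dualValue_eq, RobustPMI.Problem.riesz_f_eq_eval hy''] at hz'
  exact EReal.coe_le_coe_iff.mp hz'
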